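/- All manifolds and maps are smooth, and all vector spaces are real and finite-dimensional. A *Pfaffian group* $(G,\omega,V)$ (a Pfaffian groupoid over a point) consists of a Lie group $G$, a representation $V$ of $G$ and a one-form $\omega\in\Omega^1(G,V)$ of constant rank, with $\ker\omega$ involutive, which is multiplicative: writing $m:G\times G\to G$ for the multiplication, \[ (m^*\omega)_{(g,h)}=(\mathrm{pr}_1^*\omega)_{(g,h)}+g\cdot(\mathrm{pr}_2^*\omega)_{(g,h)},\qquad g,h\in G . \] A *morphism* $(G_1,\omega_1,V_1)\to(G_2,\omega_2,V_2)$ is a pair $(\Phi,\Psi)$ of a Lie group morphism $\Phi:G_1\to G_2$ and a linear map $\Psi:V_1\to V_2$ with $\Psi(g\cdot\alpha)=\Phi(g)\cdot\Psi(\alpha)$ and $\Phi^*\omega_2=\Psi\circ\omega_1$. Two Pfaffian groups are *Pfaffian isomorphic* if there are mutually inverse morphisms between them. A *principal Pfaffian bibundle* between $(G_1,\omega_1,V_1)$ and $(G_2,\omega_2,V_2)$ is a non-empty Hausdorff manifold $P$ with commuting smooth actions of $G_1$ from the left and of $G_2$ from the right, a one-form $\theta\in\Omega^1(P,V_1)$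 and a smooth isomorphism of vector bundles $\Phi:P\times V_1\to P\times V_2$ over $\mathrm{id}_P$, with fibre maps $\Phi_p:V_1\to V_2$, such that - each of the two actions is free, transitive and proper (i.e. $(g,p)\mapsto(g\cdot p,p)$ and $(p,h)\mapsto(p\cdot h,p)$ are proper maps); - writing $m_1:G_1\times P\to P$ and $m_2:P\times G_2\to P$ for the actions, $(m_1^*\theta)_{(g,p)}=(\mathrm{pr}_1^*\omega_1)_{(g,p)}+g\cdot(\mathrm{pr}_2^*\theta)_{(g,p)}$ for all $g\in G_1$, $p\in P$, and $\bigl(m_2^*(\Phi\circ\theta)\bigr)_{(p,h)}=h^{-1}\cdot\bigl(\mathrm{pr}_1^*(\Phi\circ\theta)\bigr)_{(p,h)}+h^{-1}\cdot(\mathrm{pr}_2^*\omega_2)_{(p,h)}$ for all $p\in P$, $h\in G_2$; - $\Phi_{g\cdot p}(g\cdot\alpha)=\Phi_p(\alpha)$ and $\Phi_{p\cdot h}(\alpha)=h^{-1}\cdot\Phi_p(\alpha)$ for all $g\in G_1$, $h\in G_2$, $p\in P$, $\alpha\in V_1$. Two Pfaffian groups are *Pfaffian Morita equivalent* if there exists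 a principal Pfaffian bibundle between them. **Corollary.** Two Pfaffian groups $(G_1,\omega_1,V_1)$ and $(G_2,\omega_2,V_2)$ are Pfaffian Morita equivalent if and only if they are Pfaffian isomorphic. -/

import Mathlib

open scoped Manifold ContDiff

universe u v

noncomputable section

namespace Pfaffian

/-- A smooth one-form on the manifold `M` (modelled on `E`) with values in the vector space `V`:
a family of linear maps `T_x M → V` that is smooth as a map `TM → V`. -/
structure OneForm (E M V : Type*)
    [NormedAddCommGroup E] [NormedSpace ℝ E]
    [TopologicalSpace M] [ChartedSpace E M] [IsManifold 𝓘(ℝ, E) ∞ M]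
    [NormedAddCommGroup V] [NormedSpace ℝ V] where
  /-- the value of the form at a point -/
  toFun : ∀ x : M, TangentSpace 𝓘(ℝ, E) x →L[ℝ] V
  smooth : ContMDiff 𝓘(ℝ, E).tangent 𝓘(ℝ, V) ∞
    (fun X : TangentBundle 𝓘(ℝ, E) M => toFun X.proj X.2)

/-- A field of tangent subspaces is involutive if the bracket of any two local smooth sections,
defined over an open set, is again a section over that set. -/
def Involutive {E M : Type*} [NormedAddCommGroup E] [NormedSpace ℝ E]
    [TopologicalSpace M] [ChartedSpace E M] [IsManifold 𝓘(ℝ, E) ∞ M]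
    (D : ∀ x : M, Submodule ℝ (TangentSpace 𝓘(ℝ, E) x)) : Prop :=
  ∀ (U : Set M), IsOpen U → ∀ X Y : (∀ x : M, TangentSpace 𝓘(ℝ, E) x),
    ContMDiffOn 𝓘(ℝ, E) 𝓘(ℝ, E).tangent ∞
      (fun x => (⟨x, X x⟩ : TangentBundle 𝓘(ℝ, E) M)) U →
    ContMDiffOn 𝓘(ℝ, E) 𝓘(ℝ, E).tangent ∞
      (fun x => (⟨x, Y x⟩ : TangentBundle 𝓘(ℝ, E) M)) U →
    (∀ x ∈ U, X x ∈ D x) → (∀ x ∈ U, Y x ∈ D x) →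
    ∀ x ∈ U, VectorField.mlieBracket 𝓘(ℝ, E) X Y x ∈ D x

/-- A Pfaffian group `(G, ω, V)`, that is, a Pfaffian groupoid over a point: a representation `V`
of the Lie group `G` and a one-form `ω ∈ Ω¹(G, V)` that is multiplicative, has constant rank and
has an involutive symbol bundle.

Over a point the source and target maps are constant, so `ker ds = ker dt = TG`: the symbol bundle
`ker ω ∩ ker ds` is `ker ω`, and the conditions `TG = ker ω + ker ds` and
`ker ω ∩ ker dt = ker ω ∩ ker ds` hold for every form. -/
structure PfaffianGroup (E G V : Type*)
    [NormedAddCommGroup E] [NormedSpace ℝ E]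
    [TopologicalSpace G] [ChartedSpace E G] [Group G] [LieGroup 𝓘(ℝ, E) ∞ G]
    [NormedAddCommGroup V] [NormedSpace ℝ V] where
  /-- the representation of `G` on `V` -/
  rep : Representation ℝ G V
  smooth_rep : ContMDiff (𝓘(ℝ, E).prod 𝓘(ℝ, V)) 𝓘(ℝ, V) ∞ (fun x : G × V => rep x.1 x.2)
  /-- the Pfaffian form -/
  form : OneForm E G V
  /-- `m^* ω = pr₁^* ω + g · pr₂^* ω` at `(g, h)` -/
  multiplicative : ∀ (g h : G) (v : TangentSpace 𝓘(ℝ, E) g) (w : TangentSpace 𝓘(ℝ, E) h),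
    form.toFun (g * h)
      (mfderiv (𝓘(ℝ, E).prod 𝓘(ℝ, E)) 𝓘(ℝ, E) (fun x : G × G => x.1 * x.2) (g, h) (v, w))
      = form.toFun g v + rep g (form.toFun h w)
  constant_rank : ∃ r : ℕ, ∀ g : G, Module.finrank ℝ (form.toFun g).range = r
  involutive : Involutive (fun g : G => (form.toFun g).ker)

section Morphisms

variable {E₁ G₁ V₁ E₂ G₂ V₂ : Type*}
  [NormedAddCommGroup E₁] [NormedSpace ℝ E₁]
  [TopologicalSpace G₁] [ChartedSpace E₁ G₁] [Group G₁] [LieGroup 𝓘(ℝ, E₁) ∞ G₁]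
  [NormedAddCommGroup V₁] [NormedSpace ℝ V₁]
  [NormedAddCommGroup E₂] [NormedSpace ℝ E₂]
  [TopologicalSpace G₂] [ChartedSpace E₂ G₂] [Group G₂] [LieGroup 𝓘(ℝ, E₂) ∞ G₂]
  [NormedAddCommGroup V₂] [NormedSpace ℝ V₂]

/-- A morphism of Pfaffian groups: a morphism of Lie groups `Φ` and a morphism of representations
`Ψ` along it, with `Φ^* ω₂ = Ψ ∘ ω₁`. -/
structure PfaffianGroup.Hom (A : PfaffianGroup E₁ G₁ V₁) (B : PfaffianGroup E₂ G₂ V₂) where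
  /-- the morphism of Lie groups -/
  onGroup : G₁ →* G₂
  smooth_onGroup : ContMDiff 𝓘(ℝ, E₁) 𝓘(ℝ, E₂) ∞ onGroup
  /-- the morphism of representations -/
  onRep : V₁ →ₗ[ℝ] V₂
  equivariant : ∀ (g : G₁) (α : V₁), onRep (A.rep g α) = B.rep (onGroup g) (onRep α)
  pullback_form : ∀ (g : G₁) (v : TangentSpace 𝓘(ℝ, E₁) g),
    B.form.toFun (onGroup g) (mfderiv 𝓘(ℝ, E₁) 𝓘(ℝ, E₂) onGroup g v) = onRep (A.form.toFun g v)

/-- Two Pfaffian groups are Pfaffian isomorphic if there are mutually inverse morphisms of Pfaffian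
groups between them. -/
def PfaffianIsomorphic (A : PfaffianGroup E₁ G₁ V₁) (B : PfaffianGroup E₂ G₂ V₂) : Prop :=
  ∃ (f : A.Hom B) (f' : B.Hom A),
    (∀ g, f'.onGroup (f.onGroup g) = g) ∧ (∀ h, f.onGroup (f'.onGroup h) = h) ∧
    (∀ α, f'.onRep (f.onRep α) = α) ∧ (∀ β, f.onRep (f'.onRep β) = β)

end Morphisms

section Bundles

variable {E G V F P : Type*}
  [NormedAddCommGroup E] [NormedSpace ℝ E]
  [TopologicalSpace G] [ChartedSpace E G] [Group G] [LieGroup 𝓘(ℝ, E) ∞ G]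
  [NormedAddCommGroup V] [NormedSpace ℝ V]
  [NormedAddCommGroup F] [NormedSpace ℝ F]
  [TopologicalSpace P] [ChartedSpace F P] [IsManifold 𝓘(ℝ, F) ∞ P]

/-- `(P, θ)` is a left principal `(G, ω, V)`-bundle over a point: the action of `G` on `P` is
smooth, transitive on the (unique) fibre of `P → pt`, free and proper, `P → pt` is surjective, and
`θ` is multiplicative.

The projection `π` and the moment map `μ` are the constant map `P → pt`; they are submersions,
`π` is invariant, and `ker dμ ∩ ker θ = ker dπ ∩ ker θ` because `ker dμ = ker dπ = TP`. -/
structure IsLeftPrincipalBundle (A : PfaffianGroup E G V) [MulAction G P]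
    (θ : OneForm F P V) : Prop where
  nonempty : Nonempty P
  smooth_action : ContMDiff (𝓘(ℝ, E).prod 𝓘(ℝ, F)) 𝓘(ℝ, F) ∞ (fun x : G × P => x.1 • x.2)
  transitive : ∀ p q : P, ∃ g : G, q = g • p
  free : ∀ (g : G) (p : P), g • p = p → g = 1
  proper : IsProperMap (fun x : G × P => (x.1 • x.2, x.2))
  /-- `m_P^* θ = pr₁^* ω + g · pr₂^* θ` at `(g, p)` -/
  multiplicative : ∀ (g : G) (p : P) (v : TangentSpace 𝓘(ℝ, E) g) (w : TangentSpace 𝓘(ℝ, F) p),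
    θ.toFun (g • p)
      (mfderiv (𝓘(ℝ, E).prod 𝓘(ℝ, F)) 𝓘(ℝ, F) (fun x : G × P => x.1 • x.2) (g, p) (v, w))
      = A.form.toFun g v + A.rep g (θ.toFun p w)

/-- `(P, η)` is a right principal `(G, ω, V)`-bundle over a point. The right action
`p · g` is `MulOpposite.op g • p`. -/
structure IsRightPrincipalBundle (A : PfaffianGroup E G V) [MulAction Gᵐᵒᵖ P]
    (η : OneForm F P V) : Prop where
  nonempty : Nonempty P
  smooth_action : ContMDiff (𝓘(ℝ, F).prod 𝓘(ℝ, E)) 𝓘(ℝ, F) ∞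
    (fun x : P × G => MulOpposite.op x.2 • x.1)
  transitive : ∀ p q : P, ∃ g : G, q = MulOpposite.op g • p
  free : ∀ (p : P) (g : G), MulOpposite.op g • p = p → g = 1
  proper : IsProperMap (fun x : P × G => (MulOpposite.op x.2 • x.1, x.1))
  /-- `m_P^* η = g⁻¹ · pr₁^* η + g⁻¹ · pr₂^* ω` at `(p, g)` -/
  multiplicative : ∀ (p : P) (g : G) (w : TangentSpace 𝓘(ℝ, F) p) (v : TangentSpace 𝓘(ℝ, E) g),
    η.toFun (MulOpposite.op g • p)
      (mfderiv (𝓘(ℝ, F).prod 𝓘(ℝ, E)) 𝓘(ℝ, F)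
        (fun x : P × G => MulOpposite.op x.2 • x.1) (p, g) (w, v))
      = A.rep g⁻¹ (η.toFun p w) + A.rep g⁻¹ (A.form.toFun g v)

end Bundles

section Bibundles

variable {F P V₁ V₂ : Type*}
  [NormedAddCommGroup F] [NormedSpace ℝ F]
  [TopologicalSpace P] [ChartedSpace F P] [IsManifold 𝓘(ℝ, F) ∞ P]
  [NormedAddCommGroup V₁] [NormedSpace ℝ V₁] [FiniteDimensional ℝ V₁]
  [NormedAddCommGroup V₂] [NormedSpace ℝ V₂]

/-- A smooth isomorphism over the identity between the trivial vector bundles `P × V₁` and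
`P × V₂`, which are the pullbacks of `V₁ → pt` and `V₂ → pt` to `P`. -/
structure TrivialBundleIso (F P V₁ V₂ : Type*)
    [NormedAddCommGroup F] [NormedSpace ℝ F] [TopologicalSpace P] [ChartedSpace F P]
    [NormedAddCommGroup V₁] [NormedSpace ℝ V₁]
    [NormedAddCommGroup V₂] [NormedSpace ℝ V₂] where
  /-- the isomorphism on the fibres over a point -/
  toFun : P → V₁ ≃ₗ[ℝ] V₂
  smooth : ContMDiff (𝓘(ℝ, F).prod 𝓘(ℝ, V₁)) 𝓘(ℝ, V₂) ∞ (fun x : P × V₁ => toFun x.1 x.2)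

/-- The form `Φ ∘ θ`. -/
def TrivialBundleIso.compForm (Φ : TrivialBundleIso F P V₁ V₂) (θ : OneForm F P V₁) :
    OneForm F P V₂ where
  toFun p := (LinearMap.toContinuousLinearMap (Φ.toFun p).toLinearMap).comp (θ.toFun p)
  smooth := Φ.smooth.comp ((Bundle.contMDiff_proj _).prodMk θ.smooth)

variable {E₁ G₁ E₂ G₂ : Type*}
  [NormedAddCommGroup E₁] [NormedSpace ℝ E₁]
  [TopologicalSpace G₁] [ChartedSpace E₁ G₁] [Group G₁] [LieGroup 𝓘(ℝ, E₁) ∞ G₁]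
  [NormedAddCommGroup E₂] [NormedSpace ℝ E₂]
  [TopologicalSpace G₂] [ChartedSpace E₂ G₂] [Group G₂] [LieGroup 𝓘(ℝ, E₂) ∞ G₂]

/-- `(P, θ, Φ)` is a principal Pfaffian bibundle between two Pfaffian groups. The last two fields
say that `Φ` is a morphism of `G₁ ⋉ P`-representations, with `P × V₂` carrying the trivial one, and
a morphism of right `P ⋊ G₂`-representations, with `P × V₁` carrying the trivial one. -/
structure IsPrincipalBibundle (A : PfaffianGroup E₁ G₁ V₁) (B : PfaffianGroup E₂ G₂ V₂)
    [MulAction G₁ P] [MulAction G₂ᵐᵒᵖ P]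
    (θ : OneForm F P V₁) (Φ : TrivialBundleIso F P V₁ V₂) : Prop where
  left : IsLeftPrincipalBundle A θ
  right : IsRightPrincipalBundle B (Φ.compForm θ)
  commute : ∀ (g : G₁) (h : G₂) (p : P),
    MulOpposite.op h • (g • p) = g • (MulOpposite.op h • p)
  left_equivariant : ∀ (g : G₁) (p : P) (α : V₁),
    Φ.toFun (g • p) (A.rep g α) = Φ.toFun p α
  right_equivariant : ∀ (p : P) (h : G₂) (α : V₁),
    Φ.toFun (MulOpposite.op h • p) α = B.rep h⁻¹ (Φ.toFun p α)

end Bibundles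



/-- Two Pfaffian groups are Pfaffian Morita equivalent if there is a principal Pfaffian bibundle
`(P, θ, Φ)` between them, on some Hausdorff finite-dimensional smooth manifold `P`. -/
def PfaffianMoritaEquivalent {E₁ E₂ : Type u} {G₁ G₂ : Type v} {V₁ V₂ : Type*}
    [NormedAddCommGroup E₁] [NormedSpace ℝ E₁]
    [TopologicalSpace G₁] [ChartedSpace E₁ G₁] [Group G₁] [LieGroup 𝓘(ℝ, E₁) ∞ G₁]
    [NormedAddCommGroup V₁] [NormedSpace ℝ V₁] [FiniteDimensional ℝ V₁]
    [NormedAddCommGroup E₂] [NormedSpace ℝ E₂]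
    [TopologicalSpace G₂] [ChartedSpace E₂ G₂] [Group G₂] [LieGroup 𝓘(ℝ, E₂) ∞ G₂]
    [NormedAddCommGroup V₂] [NormedSpace ℝ V₂]
    (A : PfaffianGroup E₁ G₁ V₁) (B : PfaffianGroup E₂ G₂ V₂) : Prop :=
  ∃ (F : Type u) (_ : NormedAddCommGroup F) (_ : NormedSpace ℝ F) (_ : FiniteDimensional ℝ F)
    (P : Type v) (_ : TopologicalSpace P) (_ : T2Space P)
    (_ : ChartedSpace F P) (_ : IsManifold 𝓘(ℝ, F) ∞ P)
    (_ : MulAction G₁ P) (_ : MulAction G₂ᵐᵒᵖ P)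
    (θ : OneForm F P V₁) (Φ : TrivialBundleIso F P V₁ V₂), IsPrincipalBibundle A B θ Φ

end Pfaffian

end

-- Over a point a principal bibundle `P` is a torsor for both groups. Fix `p` in `P`. Freeness and
-- transitivity give a bijection `φ : G₁ → G₂` with `g • p = p · φ g`. It is multiplicative because
-- the two actions commute. The orbit maps `g ↦ g • p` and `h ↦ p · h` are diffeomorphisms, so `φ`
-- is one too. The linear part is `Φ_p`: evaluating `Φ ∘ θ` along `g • p = p · φ g` through either
-- action gives `φ^* ω₂ = Φ_p ∘ ω₁`, and the two equivariance laws of `Φ` make `Φ_p` intertwine the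
-- representations.
--
-- The analytic point is that an orbit map is a diffeomorphism. Properness makes it closed, hence a
-- homeomorphism. It is an immersion because the kernel of its differential is invariant under
-- translations: the orbit map would be constant along integral curves of an invariant field in the
-- kernel, against injectivity. Equality of dimensions and the inverse function theorem conclude.
--
-- Conversely, an isomorphism turns `G₁` itself, with `θ = ω₁`, into a bibundle.

-- Equivariant bijections from a Lie group are diffeomorphisms

open Filter Topology in
/-- A smooth homeomorphism between finite-dimensional manifolds whose derivative is everywhere
injective has a smooth inverse. -/
theorem Homeomorph.contMDiff_symm_of_injective_mfderiv {E F M N : Type*}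
    [NormedAddCommGroup E] [NormedSpace ℝ E] [FiniteDimensional ℝ E]
    [NormedAddCommGroup F] [NormedSpace ℝ F] [FiniteDimensional ℝ F]
    [TopologicalSpace M] [ChartedSpace E M] [IsManifold 𝓘(ℝ, E) ∞ M]
    [TopologicalSpace N] [ChartedSpace F N] [IsManifold 𝓘(ℝ, F) ∞ N]
    (e : M ≃ₜ N) (he : ContMDiff 𝓘(ℝ, E) 𝓘(ℝ, F) ∞ e)
    (hinj : ∀ x, Function.Injective (mfderiv 𝓘(ℝ, E) 𝓘(ℝ, F) e x)) :
    ContMDiff 𝓘(ℝ, F) 𝓘(ℝ, E) ∞ e.symm := by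
  intro y
  obtain ⟨x, rfl⟩ := e.surjective y
  set c : OpenPartialHomeomorph E F :=
    (chartAt E x).symm.trans (e.toOpenPartialHomeomorph.trans (chartAt F (e x))) with hc
  set a : E := chartAt E x x with ha
  have hac : a ∈ c.source := by simp [hc, ha]
  have hca : c a = chartAt F (e x) (e x) := by simp [hc, ha]
  have hsm : ContDiffOn ℝ ∞ c c.source := by
    rw [← contMDiffOn_iff_contDiffOn]
    have h1 : ContMDiffOn 𝓘(ℝ, E) 𝓘(ℝ, E) ∞ (chartAt E x).symm (chartAt E x).target :=
      contMDiffOn_chart_symm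
    have h2 : ContMDiffOn 𝓘(ℝ, F) 𝓘(ℝ, F) ∞ (chartAt F (e x)) (chartAt F (e x)).source :=
      contMDiffOn_chart
    refine h2.comp (he.comp_contMDiffOn (h1.mono ?_)) ?_
    · intro z hz
      simp only [hc, OpenPartialHomeomorph.trans_source, Set.mem_inter_iff] at hz
      exact hz.1
    · intro z hz
      simp [hc] at hz
      exact hz.2
  obtain ⟨D, hD, hda⟩ : ∃ D : E →L[ℝ] F, Function.Injective D ∧ HasFDerivAt c D a := by
    refine ⟨mfderiv 𝓘(ℝ, E) 𝓘(ℝ, F) e x, hinj x, ?_⟩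
    exact ((he.mdifferentiableAt (by simp) (x := x)).hasMFDerivAt).2.hasFDerivAt
      (by rw [𝓘(ℝ, E).range_eq_univ]; exact univ_mem)
  have hEF : Module.finrank ℝ E = Module.finrank ℝ F := by
    refine le_antisymm
      (LinearMap.finrank_le_finrank_of_injective (f := D.toLinearMap) hD) ?_
    -- If `dim E < dim F`, the image of a ball under the smooth map `c` has dense complement, by
    -- Hausdorff dimension; but it is open, since `c` is a local homeomorphism.
    by_contra! hlt
    obtain ⟨ε, hε, hball⟩ := Metric.isOpen_iff.1 c.open_source a hac
    have hdense : Dense (c '' Metric.ball a ε)ᶜ :=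
      ((hsm.mono hball).of_le (by simp)).dense_compl_image_of_dimH_lt_finrank
        (convex_ball a ε) subset_rfl
        ((dimH_mono (Set.subset_univ _)).trans_lt (by rw [Real.dimH_univ_eq_finrank]; exact_mod_cast hlt))
    have hopen : IsOpen (c '' Metric.ball a ε) :=
      c.isOpen_image_of_subset_source Metric.isOpen_ball hball
    obtain ⟨z, hz, hz'⟩ := hdense.inter_open_nonempty _ hopen
      ⟨c a, a, Metric.mem_ball_self hε, rfl⟩
    exact hz' hz
  set L : E ≃L[ℝ] F := (LinearEquiv.ofInjectiveOfFinrankEq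
    D.toLinearMap hD hEF).toContinuousLinearEquiv
  have hL : (L : E →L[ℝ] F) = D := rfl
  have hsymm : ContDiffAt ℝ ∞ c.symm (c a) := by
    refine c.contDiffAt_symm (f₀' := L) (c.map_source hac) ?_ ?_
    · rw [c.left_inv hac, hL]; exact hda
    · rw [c.left_inv hac]; exact hsm.contDiffAt (c.open_source.mem_nhds hac)
  rw [contMDiffAt_iff]
  refine ⟨e.symm.continuous.continuousAt, ?_⟩
  rw [ModelWithCorners.range_eq_univ, contDiffWithinAt_univ]
  have : ContDiffAt ℝ ∞ c.symm (chartAt F (e x) (e x)) := hca ▸ hsymm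
  rw [e.symm_apply_apply]
  exact this

open Filter Topology in
/-- If the differential of `f` vanishes along an integral curve, `f` is constant along it; so an
injective `f` whose differential kills a `C¹` vector field has that field equal to zero. -/
theorem eq_zero_of_injective_of_mfderiv_apply_eq_zero {E F M N : Type*}
    [NormedAddCommGroup E] [NormedSpace ℝ E] [CompleteSpace E]
    [NormedAddCommGroup F] [NormedSpace ℝ F]
    [TopologicalSpace M] [ChartedSpace E M] [IsManifold 𝓘(ℝ, E) ∞ M]
    [TopologicalSpace N] [ChartedSpace F N] [IsManifold 𝓘(ℝ, F) ∞ N]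
    {f : M → N} (hf : MDifferentiable 𝓘(ℝ, E) 𝓘(ℝ, F) f) (hinj : Function.Injective f)
    (X : ∀ x : M, TangentSpace 𝓘(ℝ, E) x) (x : M)
    (hX : ContMDiffAt 𝓘(ℝ, E) 𝓘(ℝ, E).tangent 1
      (fun y => (⟨y, X y⟩ : TangentBundle 𝓘(ℝ, E) M)) x)
    (hfX : ∀ y, mfderiv 𝓘(ℝ, E) 𝓘(ℝ, F) f y (X y) = 0) : X x = 0 := by
  have : IsManifold 𝓘(ℝ, E) 1 M := .of_le (n := ∞) (by simp)
  have : IsManifold 𝓘(ℝ, F) 1 N := .of_le (n := ∞) (by simp)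
  obtain ⟨γ, hγ0, hγ⟩ := exists_isMIntegralCurveAt_of_contMDiffAt_boundaryless 0 hX
  have h1 : IsMIntegralCurveAt (f ∘ γ) (fun y : N => (0 : TangentSpace 𝓘(ℝ, F) y)) 0 := by
    filter_upwards [hγ] with t ht
    have := (hf (γ t)).hasMFDerivAt.comp t ht
    refine this.congr_mfderiv ?_
    refine ContinuousLinearMap.ext fun (s : ℝ) => ?_
    change mfderiv 𝓘(ℝ, E) 𝓘(ℝ, F) f (γ t) (s • X (γ t)) = s • (0 : TangentSpace 𝓘(ℝ, F) _)
    rw [map_smul, hfX]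
  have h2 : IsMIntegralCurveAt (fun _ => f x) (fun y : N => (0 : TangentSpace 𝓘(ℝ, F) y)) 0 := by
    filter_upwards with t
    refine (hasMFDerivAt_const (f x) t).congr_mfderiv (ContinuousLinearMap.ext fun (s : ℝ) => ?_)
    exact (smul_zero s).symm
  -- Both `f ∘ γ` and the constant curve integrate the zero field on `N`, so uniqueness of integral
  -- curves identifies them near `0`.
  have h3 : f ∘ γ =ᶠ[𝓝 0] fun _ => f x :=
    isMIntegralCurveAt_eventuallyEq_of_contMDiffAt_boundaryless
      (Bundle.contMDiff_zeroSection ℝ (TangentSpace 𝓘(ℝ, F) : N → Type _)).contMDiffAt h1 h2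
      (by simp [hγ0])
  have h4 : γ =ᶠ[𝓝 0] fun _ => x := h3.mono fun t ht => hinj ht
  have h5 := hγ.hasMFDerivAt.mfderiv
  rw [h4.mfderiv_eq, mfderiv_const] at h5
  have h6 := congrArg (fun L => L (1 : ℝ)) h5
  subst hγ0
  exact (one_smul ℝ (X (γ 0))).symm.trans h6.symm

open Filter Topology in
/-- An injective smooth map on a Lie group that intertwines the left translations with
differentiable maps of the target is an immersion. -/
theorem injective_mfderiv_of_equivariant {E F G P : Type*}
    [NormedAddCommGroup E] [NormedSpace ℝ E] [CompleteSpace E]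
    [NormedAddCommGroup F] [NormedSpace ℝ F]
    [TopologicalSpace G] [ChartedSpace E G] [Group G] [LieGroup 𝓘(ℝ, E) ∞ G]
    [TopologicalSpace P] [ChartedSpace F P] [IsManifold 𝓘(ℝ, F) ∞ P]
    {f : G → P} (hf : ContMDiff 𝓘(ℝ, E) 𝓘(ℝ, F) ∞ f) (hinj : Function.Injective f)
    (a : G → P → P) (ha : ∀ g, MDifferentiable 𝓘(ℝ, F) 𝓘(ℝ, F) (a g))
    (hequiv : ∀ g h, f (g * h) = a g (f h)) (x : G) :
    Function.Injective (mfderiv 𝓘(ℝ, E) 𝓘(ℝ, F) f x) := by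
  have hmul : ∀ g : G, MDifferentiable 𝓘(ℝ, E) 𝓘(ℝ, E) (fun h : G => g * h) := fun g =>
    (contMDiff_mul_left (I := 𝓘(ℝ, E)) (n := ∞)).mdifferentiable (by simp)
  have hfd : MDifferentiable 𝓘(ℝ, E) 𝓘(ℝ, F) f := hf.mdifferentiable (by simp)
  have : LieGroup 𝓘(ℝ, E) (minSmoothness ℝ 3) G := by
    rw [minSmoothness_of_isRCLikeNormedField]
    infer_instance
  have hd : ∀ g h (w : TangentSpace 𝓘(ℝ, E) h), mfderiv 𝓘(ℝ, E) 𝓘(ℝ, F) f h w = 0 →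
      mfderiv 𝓘(ℝ, E) 𝓘(ℝ, F) f (g * h) (mfderiv 𝓘(ℝ, E) 𝓘(ℝ, E) (fun y => g * y) h w) = 0 := by
    intro g h w hw
    rw [← mfderiv_comp_apply h (hfd (g * h)) (hmul g h)]
    rw [show f ∘ (fun y => g * y) = a g ∘ f from funext (hequiv g),
      mfderiv_comp_apply h (ha g (f h)) (hfd h), hw, map_zero]
    rfl
  have hcast : ∀ {y y' : G}, y = y' → ∀ u : E, mfderiv 𝓘(ℝ, E) 𝓘(ℝ, F) f y u = 0 →
      mfderiv 𝓘(ℝ, E) 𝓘(ℝ, F) f y' u = 0 := by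
    rintro _ _ rfl u h
    exact h
  rw [injective_iff_map_eq_zero]
  intro w hw
  -- Translate the kernel vector `w` back to the identity. By `hd`, the invariant field through the
  -- result `u` lies in the kernel at every point, so it vanishes at `x`; translating by `x` then
  -- recovers `w = 0`.
  have hu := hcast (inv_mul_cancel x) _ (hd x⁻¹ x w hw)
  set u : GroupLieAlgebra 𝓘(ℝ, E) G := mfderiv 𝓘(ℝ, E) 𝓘(ℝ, E) (fun y => x⁻¹ * y) x w
  have hXx : mulInvariantVectorField u x = 0 := by
    refine eq_zero_of_injective_of_mfderiv_apply_eq_zero hfd hinj _ x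
      ((contMDiffAt_mulInvariantVectorField u).of_le ?_) fun g => ?_
    · rw [minSmoothness_of_isRCLikeNormedField]
      norm_num
    · exact hcast (mul_one g) _ (hd g 1 u hu)
  have hcomp : mfderiv 𝓘(ℝ, E) 𝓘(ℝ, E) (fun y => x * y) (x⁻¹ * x)
      (mfderiv 𝓘(ℝ, E) 𝓘(ℝ, E) (fun y => x⁻¹ * y) x w) = w := by
    rw [← mfderiv_comp_apply x (hmul x (x⁻¹ * x)) (hmul x⁻¹ x),
      show (fun y => x * y) ∘ (fun y => x⁻¹ * y) = id from funext fun y => by simp, mfderiv_id]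
    rfl
  have hcast' : ∀ (y : G), y = 1 → ∀ u : E, mfderiv 𝓘(ℝ, E) 𝓘(ℝ, E) (fun y => x * y) 1 u = 0 →
      mfderiv 𝓘(ℝ, E) 𝓘(ℝ, E) (fun y => x * y) y u = 0 := by
    rintro _ rfl u h
    exact h
  exact hcomp.symm.trans (hcast' _ (inv_mul_cancel x) u hXx)

/-- A smooth closed bijection from a Lie group that intertwines the left translations with
differentiable maps of the target is a diffeomorphism. -/
theorem exists_homeomorph_contMDiff_symm_of_equivariant {E F G P : Type*}
    [NormedAddCommGroup E] [NormedSpace ℝ E] [FiniteDimensional ℝ E]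
    [NormedAddCommGroup F] [NormedSpace ℝ F] [FiniteDimensional ℝ F]
    [TopologicalSpace G] [ChartedSpace E G] [Group G] [LieGroup 𝓘(ℝ, E) ∞ G]
    [TopologicalSpace P] [ChartedSpace F P] [IsManifold 𝓘(ℝ, F) ∞ P]
    {f : G → P} (hf : ContMDiff 𝓘(ℝ, E) 𝓘(ℝ, F) ∞ f) (hbij : Function.Bijective f)
    (hclosed : IsClosedMap f)
    (a : G → P → P) (ha : ∀ g, MDifferentiable 𝓘(ℝ, F) 𝓘(ℝ, F) (a g))
    (hequiv : ∀ g h, f (g * h) = a g (f h)) :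
    ∃ e : G ≃ₜ P, ⇑e = f ∧ ContMDiff 𝓘(ℝ, F) 𝓘(ℝ, E) ∞ e.symm := by
  have := FiniteDimensional.complete ℝ E
  let e : G ≃ₜ P := (Equiv.ofBijective f hbij).toHomeomorphOfContinuousClosed hf.continuous hclosed
  exact ⟨e, rfl, e.contMDiff_symm_of_injective_mfderiv hf
    (injective_mfderiv_of_equivariant hf hbij.1 a ha hequiv)⟩

-- Orbit maps of principal bundles over a point

namespace Pfaffian

section Orbits

variable {E G V F P : Type*}
  [NormedAddCommGroup E] [NormedSpace ℝ E]
  [TopologicalSpace G] [ChartedSpace E G] [Group G] [LieGroup 𝓘(ℝ, E) ∞ G]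
  [NormedAddCommGroup V] [NormedSpace ℝ V]
  [NormedAddCommGroup F] [NormedSpace ℝ F]
  [TopologicalSpace P] [ChartedSpace F P] [IsManifold 𝓘(ℝ, F) ∞ P]
  {A : PfaffianGroup E G V} {θ : OneForm F P V}

theorem IsLeftPrincipalBundle.contMDiff_orbit [MulAction G P] (h : IsLeftPrincipalBundle A θ)
    (p : P) : ContMDiff 𝓘(ℝ, E) 𝓘(ℝ, F) ∞ (fun g : G => g • p) :=
  h.smooth_action.comp (contMDiff_id.prodMk contMDiff_const)

theorem IsLeftPrincipalBundle.form_mfderiv_orbit [MulAction G P]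
    (h : IsLeftPrincipalBundle A θ) (p : P) (g : G) (v : TangentSpace 𝓘(ℝ, E) g) :
    θ.toFun (g • p) (mfderiv 𝓘(ℝ, E) 𝓘(ℝ, F) (fun x : G => x • p) g v) = A.form.toFun g v := by
  have hm := h.multiplicative g p v 0
  rw [map_zero, map_zero, add_zero] at hm
  rw [← hm]
  congr 1
  have hc := mfderiv_comp_apply (I' := 𝓘(ℝ, E).prod 𝓘(ℝ, F)) g
    (g := fun x : G × P => x.1 • x.2) (f := fun x : G => (x, p))
    (h.smooth_action.mdifferentiableAt (by simp))
    (mdifferentiableAt_id.prodMk mdifferentiableAt_const) v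
  rw [mfderiv_prod_left] at hc
  exact hc

theorem IsLeftPrincipalBundle.exists_orbit_homeomorph [FiniteDimensional ℝ E]
    [FiniteDimensional ℝ F] [T1Space P] [MulAction G P] (h : IsLeftPrincipalBundle A θ) (p : P) :
    ∃ e : G ≃ₜ P, (∀ g, e g = g • p) ∧ ContMDiff 𝓘(ℝ, F) 𝓘(ℝ, E) ∞ e.symm := by
  have hinj : Function.Injective (fun g : G => g • p) := fun g g' hg => by
    have : g'⁻¹ * g = 1 := h.free _ p (by
      rw [mul_smul, inv_smul_eq_iff]
      exact hg)
    rwa [inv_mul_eq_one, eq_comm] at this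
  -- The proper map sends the closed set `C × {p}` to `(C • p) × {p}`, whose slice at `p` is `C •
  -- p`.
  have hclosed : IsClosedMap (fun g : G => g • p) := fun C hC => by
    have hprod := h.proper.isClosedMap _ (hC.prod (isClosed_singleton (x := p)))
    convert hprod.preimage (Continuous.prodMk_left p) using 1
    ext q
    simp
  obtain ⟨e, he, hs⟩ := exists_homeomorph_contMDiff_symm_of_equivariant (h.contMDiff_orbit p)
    ⟨hinj, fun q => (h.transitive p q).imp fun g hg => hg.symm⟩ hclosed (fun g q => g • q)
    (fun g => (h.smooth_action.comp (contMDiff_const.prodMk contMDiff_id)).mdifferentiable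
      (by simp)) (fun g g' => mul_smul g g' p)
  exact ⟨e, congrFun he, hs⟩

theorem IsRightPrincipalBundle.contMDiff_orbit [MulAction Gᵐᵒᵖ P]
    (h : IsRightPrincipalBundle A θ) (p : P) :
    ContMDiff 𝓘(ℝ, E) 𝓘(ℝ, F) ∞ (fun g : G => MulOpposite.op g • p) :=
  h.smooth_action.comp (contMDiff_const.prodMk contMDiff_id)

theorem IsRightPrincipalBundle.form_mfderiv_orbit [MulAction Gᵐᵒᵖ P]
    (h : IsRightPrincipalBundle A θ) (p : P) (g : G) (v : TangentSpace 𝓘(ℝ, E) g) :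
    θ.toFun (MulOpposite.op g • p)
      (mfderiv 𝓘(ℝ, E) 𝓘(ℝ, F) (fun x : G => MulOpposite.op x • p) g v)
      = A.rep g⁻¹ (A.form.toFun g v) := by
  have hm := h.multiplicative p g 0 v
  rw [map_zero, map_zero, zero_add] at hm
  rw [← hm]
  congr 1
  have hc := mfderiv_comp_apply (I' := 𝓘(ℝ, F).prod 𝓘(ℝ, E)) g
    (g := fun x : P × G => MulOpposite.op x.2 • x.1) (f := fun x : G => (p, x))
    (h.smooth_action.mdifferentiableAt (by simp))
    (mdifferentiableAt_const.prodMk mdifferentiableAt_id) v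
  rw [mfderiv_prod_right] at hc
  exact hc

theorem IsRightPrincipalBundle.exists_orbit_homeomorph [FiniteDimensional ℝ E]
    [FiniteDimensional ℝ F] [T1Space P] [MulAction Gᵐᵒᵖ P] (h : IsRightPrincipalBundle A θ)
    (p : P) :
    ∃ e : G ≃ₜ P, (∀ g, e g = MulOpposite.op g • p) ∧
      ContMDiff 𝓘(ℝ, F) 𝓘(ℝ, E) ∞ e.symm := by
  have := topologicalGroup_of_lieGroup 𝓘(ℝ, E) ∞ (G := G)
  -- The inverse turns right translations into left ones: `p · (g g')⁻¹ = (p · g'⁻¹) · g⁻¹`, the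
  -- form the equivariance criterion needs. Inversion is undone at the end.
  have hinj : Function.Injective (fun g : G => MulOpposite.op g⁻¹ • p) := fun g g' hg => by
    have : g⁻¹ * g' = 1 := h.free p _ (by
      rw [MulOpposite.op_mul, mul_smul, ← inv_inv g', MulOpposite.op_inv g'⁻¹, inv_smul_eq_iff]
      exact hg)
    rwa [inv_mul_eq_one] at this
  have hsurj : Function.Surjective (fun g : G => MulOpposite.op g⁻¹ • p) := fun q => by
    obtain ⟨g, hg⟩ := h.transitive p q
    exact ⟨g⁻¹, by simp [hg]⟩
  have hclosed : IsClosedMap (fun g : G => MulOpposite.op g⁻¹ • p) := fun C hC => by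
    have hprod := h.proper.isClosedMap _
      ((isClosed_singleton (x := p)).prod (hC.preimage (continuous_inv (G := G))))
    convert hprod.preimage (Continuous.prodMk_left p) using 1
    ext q
    constructor
    · rintro ⟨g, hg, rfl⟩
      exact ⟨(p, g⁻¹), ⟨rfl, by simpa using hg⟩, rfl⟩
    · rintro ⟨⟨p', g⟩, ⟨rfl, hg⟩, hq⟩
      exact ⟨g⁻¹, hg, by simpa using congrArg Prod.fst hq⟩
  obtain ⟨e, he, hs⟩ := exists_homeomorph_contMDiff_symm_of_equivariant
    ((h.contMDiff_orbit p).comp (contMDiff_inv 𝓘(ℝ, E) ∞)) ⟨hinj, hsurj⟩ hclosed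
    (fun g q => MulOpposite.op g⁻¹ • q)
    (fun g => (h.smooth_action.comp (contMDiff_id.prodMk contMDiff_const)).mdifferentiable
      (by simp))
    (fun g g' => by
      simp only [Function.comp_apply]
      rw [mul_inv_rev, MulOpposite.op_mul, mul_smul])
  exact ⟨(Homeomorph.inv G).trans e, fun g => by simp [he], (contMDiff_inv 𝓘(ℝ, E) ∞).comp hs⟩

end Orbits

end Pfaffian

-- Isomorphisms of Pfaffian groups

namespace Pfaffian

section Equivalence

variable {E₁ G₁ V₁ E₂ G₂ V₂ : Type*}
  [NormedAddCommGroup E₁] [NormedSpace ℝ E₁]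
  [TopologicalSpace G₁] [ChartedSpace E₁ G₁] [Group G₁] [LieGroup 𝓘(ℝ, E₁) ∞ G₁]
  [NormedAddCommGroup V₁] [NormedSpace ℝ V₁]
  [NormedAddCommGroup E₂] [NormedSpace ℝ E₂]
  [TopologicalSpace G₂] [ChartedSpace E₂ G₂] [Group G₂] [LieGroup 𝓘(ℝ, E₂) ∞ G₂]
  [NormedAddCommGroup V₂] [NormedSpace ℝ V₂]
  {A : PfaffianGroup E₁ G₁ V₁} {B : PfaffianGroup E₂ G₂ V₂}

/-- A morphism of Pfaffian groups whose two components are invertible, with a smooth inverse on the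
groups, is an isomorphism. -/
theorem PfaffianGroup.Hom.pfaffianIsomorphic (f : A.Hom B) (φ : G₁ ≃* G₂)
    (hφ : ∀ g, f.onGroup g = φ g) (hsymm : ContMDiff 𝓘(ℝ, E₂) 𝓘(ℝ, E₁) ∞ φ.symm)
    (ψ : V₁ ≃ₗ[ℝ] V₂) (hψ : ∀ α, f.onRep α = ψ α) : PfaffianIsomorphic A B := by
  have hφ' : ∀ h, f.onGroup (φ.symm h) = h := fun h => by rw [hφ, φ.apply_symm_apply]
  refine ⟨f,
    { onGroup := φ.symm.toMonoidHom
      smooth_onGroup := hsymm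
      onRep := ψ.symm.toLinearMap
      equivariant := fun h β => ?_
      pullback_form := fun h w => ?_ },
    fun g => by simp [hφ], fun h => by simp [hφ], fun α => by simp [hψ], fun β => by simp [hψ]⟩
  · have := f.equivariant (φ.symm h) (ψ.symm β)
    rw [hφ', hψ, hψ, ψ.apply_symm_apply] at this
    simp [← this]
  · have hpull := f.pullback_form (φ.symm h) (mfderiv 𝓘(ℝ, E₂) 𝓘(ℝ, E₁) φ.symm h w)
    have hcast : ∀ k : G₂, k = h → ∀ u : E₂, B.form.toFun k u = B.form.toFun h u := by
      rintro _ rfl u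
      rfl
    have hid : mfderiv 𝓘(ℝ, E₁) 𝓘(ℝ, E₂) f.onGroup (φ.symm h)
        (mfderiv 𝓘(ℝ, E₂) 𝓘(ℝ, E₁) φ.symm h w) = w := by
      rw [← mfderiv_comp_apply h (f.smooth_onGroup.mdifferentiableAt (by simp))
        (hsymm.mdifferentiableAt (by simp)),
        show f.onGroup ∘ φ.symm = id from funext hφ', mfderiv_id]
      rfl
    rw [hid, hψ] at hpull
    exact (ψ.symm_apply_eq.2 ((hcast _ (hφ' h) w).symm.trans hpull)).symm

-- From a bibundle to an isomorphism

section OfBibundle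

variable {F P : Type*} [NormedAddCommGroup F] [NormedSpace ℝ F] [FiniteDimensional ℝ V₁]
  [TopologicalSpace P] [ChartedSpace F P] [IsManifold 𝓘(ℝ, F) ∞ P]
  [MulAction G₁ P] [MulAction G₂ᵐᵒᵖ P] {θ : OneForm F P V₁} {Φ : TrivialBundleIso F P V₁ V₂}

theorem IsPrincipalBibundle.pfaffianIsomorphic [FiniteDimensional ℝ E₁] [FiniteDimensional ℝ E₂]
    [FiniteDimensional ℝ F] [T1Space P] (h : IsPrincipalBibundle A B θ Φ) :
    PfaffianIsomorphic A B := by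
  obtain ⟨p⟩ := h.left.nonempty
  obtain ⟨e₁, he₁, hs₁⟩ := h.left.exists_orbit_homeomorph p
  obtain ⟨e₂, he₂, hs₂⟩ := h.right.exists_orbit_homeomorph p
  have hc₁ : ContMDiff 𝓘(ℝ, E₁) 𝓘(ℝ, F) ∞ e₁ := by
    rw [show ⇑e₁ = _ from funext he₁]
    exact h.left.contMDiff_orbit p
  have hc₂ : ContMDiff 𝓘(ℝ, E₂) 𝓘(ℝ, F) ∞ e₂ := by
    rw [show ⇑e₂ = _ from funext he₂]
    exact h.right.contMDiff_orbit p
  have hspec : ∀ g : G₁, MulOpposite.op (e₂.symm (e₁ g)) • p = g • p := fun g => by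
    rw [← he₂, e₂.apply_symm_apply, he₁]
  let φ : G₁ ≃* G₂ :=
    { (e₁.trans e₂.symm).toEquiv with
      map_mul' := fun g g' => by
        change e₂.symm (e₁ (g * g')) = e₂.symm (e₁ g) * e₂.symm (e₁ g')
        -- `p · (φ g φ g') = (g • p) · φ g' = g • (p · φ g') = g • (g' • p)`.
        rw [e₂.symm_apply_eq, he₂, MulOpposite.op_mul, mul_smul, hspec, h.commute, hspec, he₁,
          mul_smul] }
  have hφ : ∀ g : G₁, MulOpposite.op (φ g) • p = g • p := hspec
  have hsm : ContMDiff 𝓘(ℝ, E₁) 𝓘(ℝ, E₂) ∞ φ := hs₂.comp hc₁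
  have hΦ : ∀ (g : G₁) (α : V₁), Φ.toFun (g • p) α = B.rep (φ g)⁻¹ (Φ.toFun p α) := fun g α => by
    rw [← hφ, h.right_equivariant]
  have hinv : ∀ (g : G₂) (β : V₂), B.rep g (B.rep g⁻¹ β) = β := fun g β => by
    rw [← Module.End.mul_apply, ← map_mul, mul_inv_cancel, map_one, Module.End.one_apply]
  refine PfaffianGroup.Hom.pfaffianIsomorphic
    { onGroup := φ.toMonoidHom
      smooth_onGroup := hsm
      onRep := (Φ.toFun p).toLinearMap
      equivariant := fun g α => ?_
      pullback_form := fun g v => ?_ } φ (fun _ => rfl) (hs₁.comp hc₂) (Φ.toFun p) (fun _ => rfl)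
  · have := h.left_equivariant g p α
    rw [hΦ] at this
    change Φ.toFun p (A.rep g α) = B.rep (φ g) (Φ.toFun p α)
    rw [← this, hinv]
  · change B.form.toFun (φ g) (mfderiv 𝓘(ℝ, E₁) 𝓘(ℝ, E₂) φ g v) = Φ.toFun p (A.form.toFun g v)
    have hr := h.right.form_mfderiv_orbit p (φ g) (mfderiv 𝓘(ℝ, E₁) 𝓘(ℝ, E₂) φ g v)
    rw [← mfderiv_comp_apply g ((h.right.contMDiff_orbit p).mdifferentiableAt (by simp))
      (hsm.mdifferentiableAt (by simp))] at hr
    -- The point and the differential both depend on the orbit map, so the two descriptions of the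
    -- curve are exchanged as whole functions.
    have hcast : ∀ o o' : G₁ → P, o = o' →
        (Φ.compForm θ).toFun (o g) (mfderiv 𝓘(ℝ, E₁) 𝓘(ℝ, F) o g v) =
        (Φ.compForm θ).toFun (o' g) (mfderiv 𝓘(ℝ, E₁) 𝓘(ℝ, F) o' g v) := by
      rintro _ _ rfl
      rfl
    have hl : (Φ.compForm θ).toFun (g • p) (mfderiv 𝓘(ℝ, E₁) 𝓘(ℝ, F) (fun x : G₁ => x • p) g v) =
        Φ.toFun (g • p) (A.form.toFun g v) :=
      congrArg (Φ.toFun (g • p)) (h.left.form_mfderiv_orbit p g v)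
    -- The right action yields `(φ g)⁻¹ · ω₂(dφ v)` and the left one `Φ_{g • p}(ω₁ v) = (φ g)⁻¹ ·
    -- Φ_p(ω₁ v)`; acting by `φ g` gives the claim.
    have hrl := hr.symm.trans ((hcast _ _ (funext hφ)).trans hl)
    rw [hΦ] at hrl
    simpa only [hinv] using congrArg (B.rep (φ g)) hrl

end OfBibundle

-- From an isomorphism to a bibundle

/-- The right action `p · h = p * f h` on `G₁` induced by a morphism `f` of Pfaffian groups from
`G₂` to `G₁`. -/
abbrev PfaffianGroup.Hom.rightMulAction (f : B.Hom A) : MulAction G₂ᵐᵒᵖ G₁ :=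
  MulAction.compHom G₁ f.onGroup.op

/-- The isomorphism `(p, α) ↦ f (p⁻¹ · α)` of trivial bundles over `G₁` induced by a pair of
mutually inverse morphisms. -/
def PfaffianGroup.Hom.trivialBundleIso [FiniteDimensional ℝ V₁] (f : A.Hom B) (f' : B.Hom A)
    (hl : ∀ α, f'.onRep (f.onRep α) = α) (hr : ∀ β, f.onRep (f'.onRep β) = β) :
    TrivialBundleIso E₁ G₁ V₁ V₂ where
  toFun p := LinearEquiv.ofLinearMap (f.onRep ∘ₗ A.rep p⁻¹) (A.rep p ∘ₗ f'.onRep)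
    (LinearMap.ext fun β => by simp [hr]) (LinearMap.ext fun α => by simp [hl])
  smooth := (LinearMap.toContinuousLinearMap f.onRep).contMDiff.comp
    (A.smooth_rep.comp (((contMDiff_inv 𝓘(ℝ, E₁) ∞).comp contMDiff_fst).prodMk contMDiff_snd))

/-- Properness is immediate because both shear maps are homeomorphisms. The law for `Φ ∘ θ` is
multiplicativity of `ω₁` at `(p, f' h)`, transported by `f` after acting by `(p * f' h)⁻¹`. -/
theorem PfaffianGroup.Hom.isPrincipalBibundle [FiniteDimensional ℝ V₁] (f : A.Hom B)
    (f' : B.Hom A)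
    (hgl : ∀ g, f'.onGroup (f.onGroup g) = g) (hgr : ∀ h, f.onGroup (f'.onGroup h) = h)
    (hl : ∀ α, f'.onRep (f.onRep α) = α) (hr : ∀ β, f.onRep (f'.onRep β) = β) :
    letI := f'.rightMulAction
    IsPrincipalBibundle (F := E₁) (P := G₁) A B A.form (f.trivialBundleIso f' hl hr) := by
  let _ := f'.rightMulAction
  have := topologicalGroup_of_lieGroup 𝓘(ℝ, E₁) ∞ (G := G₁)
  have hact : ∀ (h : G₂) (p : G₁), MulOpposite.op h • p = p * f'.onGroup h := fun _ _ => rfl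
  have hΦ : ∀ (p : G₁) (α : V₁),
      (f.trivialBundleIso f' hl hr).toFun p α = f.onRep (A.rep p⁻¹ α) := fun _ _ => rfl
  have hrep : ∀ (p : G₁) (h : G₂) (α : V₁),
      f.onRep (A.rep (p * f'.onGroup h)⁻¹ α) = B.rep h⁻¹ (f.onRep (A.rep p⁻¹ α)) := fun p h α => by
    rw [mul_inv_rev, map_mul, Module.End.mul_apply, f.equivariant, map_inv, hgr]
  have hmul : ContMDiff (𝓘(ℝ, E₁).prod 𝓘(ℝ, E₁)) 𝓘(ℝ, E₁) ∞ (fun x : G₁ × G₁ => x.1 * x.2) :=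
    contMDiff_mul 𝓘(ℝ, E₁) ∞
  refine ⟨⟨⟨1⟩, hmul, fun p q => ⟨q * p⁻¹, by simp⟩, fun g p hg => by simpa using hg, ?_,
    A.multiplicative⟩, ⟨⟨1⟩, ?_, fun p q => ⟨f.onGroup (p⁻¹ * q), by rw [hact, hgl, mul_inv_cancel_left]⟩,
    fun p h hp => ?_, ?_, fun p h w v => ?_⟩, fun g h p => ?_, fun g p α => ?_, fun p h α => ?_⟩
  · let e : G₁ × G₁ ≃ₜ G₁ × G₁ :=
      { toFun := fun x => (x.1 * x.2, x.2)
        invFun := fun x => (x.1 * x.2⁻¹, x.2)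
        left_inv := fun x => by simp
        right_inv := fun x => by simp
        continuous_toFun := by fun_prop
        continuous_invFun := by fun_prop }
    exact e.isProperMap
  · exact hmul.comp (contMDiff_fst.prodMk (f'.smooth_onGroup.comp contMDiff_snd))
  · rw [hact, mul_eq_left] at hp
    rw [← hgr h, hp, map_one]
  · have hf := f.smooth_onGroup.continuous
    have hf' := f'.smooth_onGroup.continuous
    let e : G₁ × G₂ ≃ₜ G₁ × G₁ :=
      { toFun := fun x => (x.1 * f'.onGroup x.2, x.1)
        invFun := fun x => (x.2, f.onGroup (x.2⁻¹ * x.1))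
        left_inv := fun x => by simp [hgr]
        right_inv := fun x => by simp [hgl]
        continuous_toFun := by fun_prop
        continuous_invFun := by fun_prop }
    exact e.isProperMap
  · have hd : MDifferentiableAt 𝓘(ℝ, E₂) 𝓘(ℝ, E₁) f'.onGroup h :=
      f'.smooth_onGroup.mdifferentiableAt (by simp)
    have hc := mfderiv_comp_apply (I := 𝓘(ℝ, E₁).prod 𝓘(ℝ, E₂))
      (I' := 𝓘(ℝ, E₁).prod 𝓘(ℝ, E₁)) (I'' := 𝓘(ℝ, E₁)) (p, h)
      (g := fun x : G₁ × G₁ => x.1 * x.2) (f := Prod.map id f'.onGroup)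
      (hmul.mdifferentiableAt (by simp)) (mdifferentiableAt_id.prodMap hd) (w, v)
    rw [mfderiv_prodMap mdifferentiableAt_id hd, mfderiv_id] at hc
    have hm := A.multiplicative p (f'.onGroup h) w (mfderiv 𝓘(ℝ, E₂) 𝓘(ℝ, E₁) f'.onGroup h v)
    rw [f'.pullback_form] at hm
    have hη := (congrArg (A.form.toFun (p * f'.onGroup h)) hc).trans hm
    refine (congrArg (fun α => f.onRep (A.rep (p * f'.onGroup h)⁻¹ α)) hη).trans ?_
    change f.onRep (A.rep (p * f'.onGroup h)⁻¹ _) =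
      B.rep h⁻¹ (f.onRep (A.rep p⁻¹ (A.form.toFun p w))) + B.rep h⁻¹ (B.form.toFun h v)
    -- In the second term the factor `p` from multiplicativity cancels the `p⁻¹` left by `hrep`, and
    -- `f ∘ f' = id` on representations leaves `h⁻¹ · ω₂(v)`.
    rw [map_add, map_add, hrep, hrep]
    simp [hr]
  · simp only [hact, smul_eq_mul, mul_assoc]
  · simp [hΦ]
  · rw [hΦ, hΦ, hact, hrep]

end Equivalence

end Pfaffian

theorem mainTheorem5 {E₁ E₂ : Type u} {G₁ G₂ : Type v} {V₁ V₂ : Type*}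
    [NormedAddCommGroup E₁] [NormedSpace ℝ E₁] [FiniteDimensional ℝ E₁]
    [TopologicalSpace G₁] [T2Space G₁] [ChartedSpace E₁ G₁] [Group G₁] [LieGroup 𝓘(ℝ, E₁) ∞ G₁]
    [NormedAddCommGroup V₁] [NormedSpace ℝ V₁] [FiniteDimensional ℝ V₁]
    [NormedAddCommGroup E₂] [NormedSpace ℝ E₂] [FiniteDimensional ℝ E₂]
    [TopologicalSpace G₂] [T2Space G₂] [ChartedSpace E₂ G₂] [Group G₂] [LieGroup 𝓘(ℝ, E₂) ∞ G₂]
    [NormedAddCommGroup V₂] [NormedSpace ℝ V₂] [FiniteDimensional ℝ V₂]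
    (A : Pfaffian.PfaffianGroup E₁ G₁ V₁) (B : Pfaffian.PfaffianGroup E₂ G₂ V₂) :
    Pfaffian.PfaffianMoritaEquivalent A B ↔ Pfaffian.PfaffianIsomorphic A B := by
  constructor
  · rintro ⟨F, _, _, _, P, _, _, _, _, _, _, θ, Φ, h⟩
    exact h.pfaffianIsomorphic
  · rintro ⟨f, f', hgl, hgr, hl, hr⟩
    exact ⟨E₁, _, _, inferInstance, G₁, _, inferInstance, _, inferInstance, _, f'.rightMulAction,
      A.form, _, f.isPrincipalBibundle f' hgl hgr hl hr⟩
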